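/- Let $S$ be a compact Polish space, $K\ge 0$, and let $(V_t)_{t\ge0}$ be an $S$-valued càdlàg Feller process on $(\Omega,\mathcal F,(\mathcal F_t)_{t\ge0},(\mathbb P_x)_{x\in S})$, where $\mathbb P_x(V_0=x)=1$ and $x\mapsto\mathbb P_x(A)$ is measurable for every $A\in\mathcal F$. For a probability measure $\mu$ on $S$ put $\mathbb P_\mu:=\int_S\mathbb P_y(\cdot)\,\mu(\mathrm dy)$. Assume: (a) $(V_t)_{t\ge0}$ has a unique invariant probability measure $\pi$; and there are constants $C,\delta>0$ such that for every $x\in S$ there are processes $(V^x_t)_{t\ge0}$ and $(V^\pi_t)_{t\ge0}$ on a common filtered probability space $(\tilde\Omega,\tilde{\mathcal F},(\mathcal G_t)_{t\ge 0},\tilde{\mathbb P})$, both adapted, which have the finite-dimensional distributions of $(V_t)_{t\ge0}$ under $\mathbb P_x$ and under $\mathbb P_\pi$, respectively, and for which $T^x:=\inf\{t\ge0 : V^x_t=V^\pi_t\}$ is a stopping time with $\tilde{\mathbb P}(T^x\ge t)\le C e^{-\delta t}$ for all $t\ge0$. (b) $f:\mathbb R^K\times S\to\mathbb R$ is continuous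 and twice continuously differentiable in $\theta$, with $\nabla_\theta f$ and the Hessian $H_\theta f$ continuous on $\mathbb R^K\times S$; $\nabla_\theta f(\cdot,y)$ is Lipschitz with a constant independent of $y\in S$; and $f(\theta,\cdot)$ and $\nabla_\theta f(\theta,\cdot)$ are $\pi$-integrable for every $\theta\in\mathbb R^K$. Fix $\theta_0\in\mathbb R^K$. For $\varepsilon\in(0,1)$ let $(\theta^\varepsilon_t)_{t\ge0}$ be the stochastic gradient process, i.e. the process with continuous paths solving $$\mathrm d\theta^\varepsilon_t=-\nabla_\theta f(\theta^\varepsilon_t,V_{t/\varepsilon})\,\mathrm dt,\qquad \theta^\varepsilon_0=\theta_0,$$ and let $(\zeta_t)_{t\ge0}$ be the full gradient flow $$\mathrm d\zeta_t=-\Big[\int_S\nabla_\theta f(\zeta_t,v)\,\pi(\mathrm dv)\Big]\mathrm dt,\qquad \zeta_0=\theta_0.$$ For probability measures $\nu,\nu'$ on $\mathbb R^K$ let $$\mathcal W_d(\nu,\nu')=\inf_\Gamma\int_{\mathbb R^K\times\mathbb R^K}\big(1\wedge\|y-y'\|\big)\,\Gamma(\mathrm dy,\mathrm dy'),$$ the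 infimum being over all couplings $\Gamma$ of $\nu$ and $\nu'$, and let $C^\varepsilon_t(\cdot|\theta_0,\pi)$ be the law of $\theta^\varepsilon_t$ under $\mathbb P_\pi$. Then there is a function $\alpha:(0,1)\to[0,1]$ with $\lim_{\varepsilon\to0}\alpha(\varepsilon)=0$ such that, for all $\varepsilon\in(0,1)$ and all $t\ge0$, $$\mathcal W_d\big(C^\varepsilon_t(\cdot|\theta_0,\pi),\delta_{\zeta_t}\big)\le\big(e^t\alpha(\varepsilon)\big)\wedge1.$$ -/

import Mathlib

open MeasureTheory ProbabilityTheory Filter Topology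
open scoped NNReal ENNReal

universe u v w

namespace SGP

/-- Two `S`-valued processes, on possibly different probability spaces, have the same
finite-dimensional distributions. -/
def SameFDD {S Ω₁ Ω₂ : Type*} [MeasurableSpace S] [MeasurableSpace Ω₁] [MeasurableSpace Ω₂]
    (P₁ : Measure Ω₁) (X : ℝ≥0 → Ω₁ → S) (P₂ : Measure Ω₂) (Y : ℝ≥0 → Ω₂ → S) : Prop :=
  ∀ (n : ℕ) (t : Fin n → ℝ≥0), StrictMono t →
    ∀ A : Fin n → Set S, (∀ i, MeasurableSet (A i)) →
      P₁ {ω | ∀ i, X (t i) ω ∈ A i} = P₂ {ω | ∀ i, Y (t i) ω ∈ A i}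

/-- The first meeting time `inf {t ≥ 0 | X_t = Y_t}` of two processes (`⊤` if they never meet). -/
noncomputable def meetingTime {S Ω : Type*} (X Y : ℝ≥0 → Ω → S) (ω : Ω) : WithTop ℝ≥0 :=
  sInf ((fun t : ℝ≥0 => (t : WithTop ℝ≥0)) '' {t | X t ω = Y t ω})

/-- `V` is a càdlàg Feller process with respect to the filtration `ℱ` and the family
`(P x)` of probability measures, `P x` being the law of the process started in `x`.
(Strong continuity of the semigroup at `0` follows from `start` and right continuity.) -/
structure IsFellerProcess {S Ω : Type*} [TopologicalSpace S] [MeasurableSpace S]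
    {mΩ : MeasurableSpace Ω} (ℱ : Filtration ℝ≥0 mΩ) (P : Kernel S Ω) (V : ℝ≥0 → Ω → S) :
    Prop where
  adapted : ∀ t, Measurable[ℱ t] (V t)
  right_continuous : ∀ ω t, ContinuousWithinAt (fun s => V s ω) (Set.Ici t) t
  left_limits : ∀ ω t, ∃ l, Tendsto (fun s => V s ω) (𝓝[<] t) (𝓝 l)
  start : ∀ x, ∀ᵐ ω ∂(P x), V 0 ω = x
  markov : ∀ (x : S) (s t : ℝ≥0) (h : S → ℝ), Measurable h → (∃ C, ∀ y, |h y| ≤ C) →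
    (P x)[fun ω => h (V (s + t) ω) | ℱ s] =ᵐ[P x] fun ω => ∫ ω', h (V t ω') ∂(P (V s ω))
  feller : ∀ (t : ℝ≥0) (h : S → ℝ), Continuous h → Continuous fun x => ∫ ω, h (V t ω) ∂(P x)

/-- The law `P_μ = ∫ P_y μ(dy)` of the process with initial distribution `μ`. -/
noncomputable def startLaw {S Ω : Type*} [MeasurableSpace S] [MeasurableSpace Ω]
    (P : Kernel S Ω) (μ : Measure S) : Measure Ω :=
  μ.bind P

/-- `μ` is invariant: if `V_0` is distributed according to `μ`, then so is `V_t`, for all `t`. -/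
def IsInvariant {S Ω : Type*} [MeasurableSpace S] [MeasurableSpace Ω]
    (P : Kernel S Ω) (V : ℝ≥0 → Ω → S) (μ : Measure S) : Prop :=
  ∀ t, (startLaw P μ).map (V t) = μ

/-- The assumption on the index process: `π` is its unique invariant probability measure, and
for every `x` a version started in `x` and a stationary version can be defined on one
probability space so that they meet exponentially fast, uniformly in `x`. -/
structure IndexAssumption {S : Type u} {Ω : Type v} [MeasurableSpace S]
    [MeasurableSpace Ω] (P : Kernel S Ω) (V : ℝ≥0 → Ω → S) (π : Measure S) : Prop where
  prob : IsProbabilityMeasure π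
  invariant : IsInvariant P V π
  unique : ∀ μ : Measure S, IsProbabilityMeasure μ → IsInvariant P V μ → μ = π
  coupling : ∃ C δ : ℝ, 0 < C ∧ 0 < δ ∧ ∀ x : S,
    ∃ (Ω' : Type w) (mΩ' : MeasurableSpace Ω') (P' : Measure Ω') (𝒢 : Filtration ℝ≥0 mΩ')
      (X Y : ℝ≥0 → Ω' → S),
      IsProbabilityMeasure P' ∧
      (∀ t, Measurable[𝒢 t] (X t)) ∧ (∀ t, Measurable[𝒢 t] (Y t)) ∧
      SameFDD P' X (P x) V ∧ SameFDD P' Y (startLaw P π) V ∧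
      IsStoppingTime 𝒢 (meetingTime X Y) ∧
      ∀ t : ℝ≥0, P' {ω | (t : WithTop ℝ≥0) ≤ meetingTime X Y ω} ≤
        ENNReal.ofReal (C * Real.exp (-δ * t))

/-- The regularity assumption on the subsampled target function `f(θ, y)`. -/
structure TargetAssumption {K : ℕ} {S : Type*} [TopologicalSpace S] [MeasurableSpace S]
    (f : EuclideanSpace ℝ (Fin K) → S → ℝ) (π : Measure S) : Prop where
  contDiff : ∀ y, ContDiff ℝ 2 fun θ => f θ y
  continuous : Continuous fun p : EuclideanSpace ℝ (Fin K) × S => f p.1 p.2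
  continuous_gradient : Continuous fun p : EuclideanSpace ℝ (Fin K) × S =>
    gradient (fun θ => f θ p.2) p.1
  continuous_hessian : Continuous fun p : EuclideanSpace ℝ (Fin K) × S =>
    fderiv ℝ (gradient fun θ => f θ p.2) p.1
  lipschitz : ∃ L : ℝ≥0, ∀ y, LipschitzWith L (gradient fun θ => f θ y)
  integrable : ∀ θ, Integrable (f θ) π
  integrable_gradient : ∀ θ, Integrable (fun y => gradient (fun θ' => f θ' y) θ) π

/-- `θ` is a stochastic gradient process with constant learning rate and scaling parameter `ε`,
started in `θ₀`: a process with continuous paths that solves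
`dθ_t = -∇_θ f(θ_t, V_{t/ε}) dt` for `t ≥ 0`, almost surely under `Q`. -/
structure IsSGPC {K : ℕ} {S Ω : Type*} [MeasurableSpace Ω] (Q : Measure Ω)
    (f : EuclideanSpace ℝ (Fin K) → S → ℝ) (V : ℝ≥0 → Ω → S) (ε : ℝ)
    (θ₀ : EuclideanSpace ℝ (Fin K)) (θ : ℝ → Ω → EuclideanSpace ℝ (Fin K)) : Prop where
  measurable : ∀ t, 0 ≤ t → Measurable (θ t)
  continuous : ∀ᵐ ω ∂Q, ContinuousOn (fun t => θ t ω) (Set.Ici 0)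
  equation : ∀ᵐ ω ∂Q, ∀ t, 0 ≤ t →
    θ t ω = θ₀ - ∫ s in (0 : ℝ)..t,
      gradient (fun x => f x (V (Real.toNNReal (s / ε)) ω)) (θ s ω)

/-- `ζ` is the full gradient flow `dζ_t = -(∫ ∇_θ f(ζ_t, v) π(dv)) dt`, `t ≥ 0`, from `θ₀`. -/
structure IsFullGradientFlow {K : ℕ} {S : Type*} [MeasurableSpace S] (π : Measure S)
    (f : EuclideanSpace ℝ (Fin K) → S → ℝ) (θ₀ : EuclideanSpace ℝ (Fin K))
    (ζ : ℝ → EuclideanSpace ℝ (Fin K)) : Prop where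
  initial : ζ 0 = θ₀
  equation : ∀ t, 0 ≤ t →
    HasDerivWithinAt ζ (-∫ v, gradient (fun x => f x v) (ζ t) ∂π) (Set.Ici 0) t

/-- `Γ` is a coupling of `ν` and `ν'`. -/
def IsCoupling {E : Type*} [MeasurableSpace E] (ν ν' : Measure E) (Γ : Measure (E × E)) : Prop :=
  IsProbabilityMeasure Γ ∧ Γ.map Prod.fst = ν ∧ Γ.map Prod.snd = ν'

/-- The Wasserstein distance for the truncated metric `d(y, y') = min 1 ‖y - y'‖`. -/
noncomputable def wassersteinTrunc {E : Type*} [NormedAddCommGroup E] [MeasurableSpace E]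
    (ν ν' : Measure E) : ℝ≥0∞ :=
  ⨅ (Γ : Measure (E × E)) (_ : IsCoupling ν ν' Γ),
    ∫⁻ p, ENNReal.ofReal (min 1 ‖p.1 - p.2‖) ∂Γ

end SGP

set_option linter.unusedSectionVars false

/-! This is an averaging principle. On a compact space, a Feller process with a unique invariant
measure has time averages of `h` that converge to `∫ h dπ` in mean, uniformly in the starting point:
any weak limit of occupation measures is invariant, hence equals `π`
(`IsFellerProcess.uniform_ergodic`).

For centred `h`, stationarity and the Markov property reduce the second moment of `∫₀ᵀ h(V_s) ds` to
time integrals of correlations. The uniform ergodic bound makes these `o(T)`, so the second moment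
is `o(T²)`. Rescaling time gives an `L¹` ergodic theorem
(`IsFellerProcess.tendsto_integral_abs_intervalIntegral`).

Freezing `ζ` on a fine grid extends this to `∇f(ζ_s, v) - ∫ ∇f(ζ_s, ·) dπ`, uniformly over `[0, T]`
(`IsFellerProcess.exists_averaging_bound`). Grönwall's inequality passes from this fluctuation to
`θ^ε - ζ`. The truncated distance is at most `1`, so weighting by `e^{-t}` makes large times
negligible, and the supremum over `t` of the weighted mean distance serves as `α(ε)`. -/

namespace SGP

/-! ### Measurability, transition semigroup and uniform mean ergodicity. -/

section Markov

variable {S : Type u} [TopologicalSpace S] [PolishSpace S] [CompactSpace S]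
    [MeasurableSpace S] [BorelSpace S] {Ω : Type v} {mΩ : MeasurableSpace Ω}
    {ℱ : Filtration ℝ≥0 mΩ} {P : Kernel S Ω} {V : ℝ≥0 → Ω → S}

/-- The transition operators `h ↦ E_x[h(V_t)]`. -/
noncomputable def semigroup (P : Kernel S Ω) (V : ℝ≥0 → Ω → S) (t : ℝ≥0) (h : S → ℝ) (x : S) : ℝ :=
  ∫ ω, h (V t ω) ∂(P x)

lemma exists_abs_le_of_continuous {X : Type*} [TopologicalSpace X] [CompactSpace X] {h : X → ℝ}
    (hh : Continuous h) : ∃ M, 0 ≤ M ∧ ∀ y, |h y| ≤ M := by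
  obtain ⟨M, hM⟩ := isCompact_univ.exists_bound_of_continuousOn hh.continuousOn
  exact ⟨max M 0, le_max_right _ _, fun y => (hM y trivial).trans (le_max_left _ _)⟩

lemma integral_startLaw {μ : Measure S} [IsFiniteMeasure μ] [IsMarkovKernel P] {g : Ω → ℝ}
    (hg : Integrable g (startLaw P μ)) :
    ∫ ω, g ω ∂(startLaw P μ) = ∫ x, ∫ ω, g ω ∂(P x) ∂μ := by
  have h := Kernel.integral_comp (η := P) (κ := Kernel.const Unit μ) (a := ()) (f := g)
  rw [Kernel.comp_apply, Kernel.const_apply] at h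
  exact h hg

instance isProbabilityMeasure_startLaw {μ : Measure S} [IsProbabilityMeasure μ]
    [IsMarkovKernel P] : IsProbabilityMeasure (startLaw P μ) := by
  unfold startLaw; infer_instance

lemma IsFellerProcess.measurable (hV : IsFellerProcess ℱ P V) (t : ℝ≥0) : Measurable (V t) :=
  (hV.adapted t).mono (ℱ.le t) le_rfl

lemma IsFellerProcess.measurable_floor (hV : IsFellerProcess ℱ P V) (d : ℕ → ℝ≥0) (c : ℝ≥0) :
    Measurable fun p : ℝ≥0 × Ω => V (d ⌊c * p.1⌋₊) p.2 := by
  have h1 : Measurable fun q : ℕ × Ω => V (d q.1) q.2 :=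
    measurable_from_prod_countable_right fun k => hV.measurable (d k)
  have h2 : Measurable fun p : ℝ≥0 × Ω => (⌊c * p.1⌋₊, p.2) :=
    (Nat.measurable_floor.comp (measurable_fst.const_mul _)).prodMk measurable_snd
  exact h1.comp h2

lemma IsFellerProcess.measurable_uncurry (hV : IsFellerProcess ℱ P V) :
    Measurable fun p : ℝ≥0 × Ω => V p.1 p.2 := by
  -- The `+ 1` places the grid point to the right of `s`, so right continuity gives convergence of
  -- the discretised processes.
  let τ : ℕ → ℝ≥0 → ℝ≥0 := fun n s => ((⌊((n : ℝ≥0) + 1) * s⌋₊ : ℝ≥0) + 1) / ((n : ℝ≥0) + 1)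
  have hτ_ge : ∀ n s, s ≤ τ n s := fun n s => by
    have : (0 : ℝ≥0) < (n : ℝ≥0) + 1 := by positivity
    rw [le_div_iff₀ this, mul_comm]
    exact (Nat.lt_floor_add_one _).le
  have hτ_le : ∀ n s, τ n s ≤ s + 1 / ((n : ℝ≥0) + 1) := fun n s => by
    have : (0 : ℝ≥0) < (n : ℝ≥0) + 1 := by positivity
    rw [div_le_iff₀ this, add_mul s, div_mul_cancel₀ _ this.ne', mul_comm s]
    gcongr
    exact Nat.floor_le (by positivity)
  have hτ : ∀ s, Tendsto (fun n => τ n s) atTop (𝓝[≥] s) := fun s => by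
    refine tendsto_nhdsWithin_iff.2 ⟨?_, Eventually.of_forall fun n => hτ_ge n s⟩
    refine tendsto_of_tendsto_of_tendsto_of_le_of_le tendsto_const_nhds ?_
      (fun n => hτ_ge n s) (fun n => hτ_le n s)
    have h0 : Tendsto (fun n : ℕ => 1 / ((n : ℝ≥0) + 1)) atTop (𝓝 0) := by
      rw [← NNReal.tendsto_coe]
      push_cast
      exact tendsto_one_div_add_atTop_nhds_zero_nat
    simpa using tendsto_const_nhds.add h0
  refine measurable_of_tendsto_metrizable (f := fun n (p : ℝ≥0 × Ω) => V (τ n p.1) p.2) ?_ ?_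
  · intro n
    exact hV.measurable_floor (fun k => ((k : ℝ≥0) + 1) / ((n : ℝ≥0) + 1)) _
  · exact tendsto_pi_nhds.2 fun p => (hV.right_continuous p.2 p.1).tendsto.comp (hτ p.1)

lemma IsFellerProcess.measurable_real (hV : IsFellerProcess ℱ P V) :
    Measurable fun p : ℝ × Ω => V p.1.toNNReal p.2 :=
  hV.measurable_uncurry.comp (measurable_real_toNNReal.prodMap measurable_id)

lemma IsFellerProcess.integrable_comp (hV : IsFellerProcess ℱ P V) {Q : Measure Ω}
    [IsFiniteMeasure Q] {h : S → ℝ} (hh : Continuous h) (t : ℝ≥0) :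
    Integrable (fun ω => h (V t ω)) Q := by
  obtain ⟨M, -, hM⟩ := exists_abs_le_of_continuous hh
  exact Integrable.of_bound (hh.measurable.comp (hV.measurable t)).aestronglyMeasurable M
    (ae_of_all _ fun ω => hM _)

lemma IsFellerProcess.continuous_semigroup (hV : IsFellerProcess ℱ P V) (t : ℝ≥0) {h : S → ℝ}
    (hh : Continuous h) : Continuous (semigroup P V t h) :=
  hV.feller t h hh

lemma abs_semigroup_le [IsMarkovKernel P] {h : S → ℝ} {M : ℝ} (hM : ∀ y, |h y| ≤ M) (t : ℝ≥0)
    (x : S) : |semigroup P V t h x| ≤ M := by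
  have := norm_integral_le_of_norm_le_const (μ := P x) (f := fun ω => h (V t ω)) (C := M)
    (ae_of_all _ fun ω => hM _)
  simpa [semigroup] using this

/-- Two-point correlations of the process under `P_x`. -/
lemma IsFellerProcess.integral_mul_comp [IsMarkovKernel P] (hV : IsFellerProcess ℱ P V)
    {h k : S → ℝ} (hh : Continuous h) (hk : Continuous k) (x : S) (r t : ℝ≥0) :
    ∫ ω, h (V r ω) * k (V (r + t) ω) ∂(P x) =
      ∫ ω, h (V r ω) * semigroup P V t k (V r ω) ∂(P x) := by
  obtain ⟨M, -, hM⟩ := exists_abs_le_of_continuous hk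
  obtain ⟨N, -, hN⟩ := exists_abs_le_of_continuous hh
  have hm : StronglyMeasurable[ℱ r] fun ω => h (V r ω) :=
    (hh.measurable.comp (hV.adapted r)).stronglyMeasurable
  have hint : Integrable (fun ω => h (V r ω) * k (V (r + t) ω)) (P x) :=
    (hV.integrable_comp hk _).bdd_mul (hm.mono (ℱ.le r)).aestronglyMeasurable
      (ae_of_all _ fun ω => hN _)
  rw [← integral_condExp (ℱ.le r)]
  refine integral_congr_ae ?_
  have h1 := condExp_mul_of_stronglyMeasurable_left (μ := P x) hm hint (hV.integrable_comp hk _)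
  filter_upwards [h1, hV.markov x r t k hk.measurable ⟨M, hM⟩] with ω h1 h2
  exact h1.trans (congrArg (h (V r ω) * ·) h2)

lemma IsFellerProcess.semigroup_add [IsMarkovKernel P] (hV : IsFellerProcess ℱ P V)
    {k : S → ℝ} (hk : Continuous k) (x : S) (r t : ℝ≥0) :
    semigroup P V (r + t) k x = semigroup P V r (semigroup P V t k) x := by
  simpa [semigroup] using hV.integral_mul_comp (h := fun _ => (1 : ℝ)) continuous_const hk x r t

lemma IsFellerProcess.integral_startLaw_comp [IsMarkovKernel P] (hV : IsFellerProcess ℱ P V)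
    {μ : Measure S} [IsFiniteMeasure μ] {h : S → ℝ} (hh : Continuous h) (t : ℝ≥0) :
    ∫ ω, h (V t ω) ∂(startLaw P μ) = ∫ x, semigroup P V t h x ∂μ := by
  have : IsFiniteMeasure (startLaw P μ) := by unfold startLaw; infer_instance
  exact integral_startLaw (hV.integrable_comp hh t)

lemma IsFellerProcess.measurable_semigroup [IsMarkovKernel P] (hV : IsFellerProcess ℱ P V)
    {h : S → ℝ} (hh : Continuous h) :
    Measurable fun p : ℝ × S => semigroup P V p.1.toNNReal h p.2 := by
  have h1 : StronglyMeasurable (Function.uncurry fun (p : ℝ × S) (ω : Ω) =>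
      h (V p.1.toNNReal ω)) := by
    refine Measurable.stronglyMeasurable ?_
    exact hh.measurable.comp (hV.measurable_real.comp
      ((measurable_fst.comp measurable_fst).prodMk measurable_snd))
  exact (h1.integral_kernel_prod_right' (κ := P.comap Prod.snd measurable_snd)).measurable

lemma IsFellerProcess.intervalIntegrable_semigroup [IsMarkovKernel P] (hV : IsFellerProcess ℱ P V)
    {h : S → ℝ} (hh : Continuous h) (x : S) (a b : ℝ) :
    IntervalIntegrable (fun s => semigroup P V s.toNNReal h x) volume a b := by
  obtain ⟨M, -, hM⟩ := exists_abs_le_of_continuous hh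
  rw [intervalIntegrable_iff]
  have : IsFiniteMeasure (volume.restrict (Set.uIoc a b)) :=
    ⟨by rw [Measure.restrict_apply_univ, Set.uIoc]; exact measure_Ioc_lt_top⟩
  refine Integrable.of_bound ((hV.measurable_semigroup hh).comp
    measurable_prodMk_right).aestronglyMeasurable M (ae_of_all _ fun s => abs_semigroup_le hM _ _)

/-- The average occupation measure over `[0, T]` of the process started in `x`. -/
noncomputable def occupation (P : Kernel S Ω) (V : ℝ≥0 → Ω → S) (x : S) (T : ℝ) : Measure S :=
  (((ENNReal.ofReal T)⁻¹ • volume.restrict (Set.Ioc 0 T)).prod (P x)).map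
    fun p : ℝ × Ω => V p.1.toNNReal p.2

lemma IsFellerProcess.isProbabilityMeasure_occupation [IsMarkovKernel P]
    (hV : IsFellerProcess ℱ P V) (x : S) {T : ℝ} (hT : 0 < T) :
    IsProbabilityMeasure (occupation P V x T) := by
  have : IsProbabilityMeasure ((ENNReal.ofReal T)⁻¹ • volume.restrict (Set.Ioc 0 T)) :=
    ⟨by simp [ENNReal.inv_mul_cancel, hT]⟩
  exact Measure.isProbabilityMeasure_map hV.measurable_real.aemeasurable

lemma IsFellerProcess.integral_occupation [IsMarkovKernel P]
    (hV : IsFellerProcess ℱ P V) (x : S) {T : ℝ} (hT : 0 < T) {k : S → ℝ} (hk : Continuous k) :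
    ∫ y, k y ∂(occupation P V x T) = T⁻¹ * ∫ s in (0 : ℝ)..T, semigroup P V s.toNNReal k x := by
  obtain ⟨M, -, hM⟩ := exists_abs_le_of_continuous hk
  have : IsProbabilityMeasure ((ENNReal.ofReal T)⁻¹ • volume.restrict (Set.Ioc 0 T)) :=
    ⟨by simp [ENNReal.inv_mul_cancel, hT]⟩
  rw [occupation, integral_map hV.measurable_real.aemeasurable hk.aestronglyMeasurable,
    integral_prod]
  · rw [integral_smul_measure, intervalIntegral.integral_of_le hT.le]
    simp [ENNReal.toReal_inv, hT.le, semigroup]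
  · exact Integrable.of_bound (hk.measurable.comp hV.measurable_real).aestronglyMeasurable M
      (ae_of_all _ fun _ => hM _)

/-- Applying the time-`t` operator shifts the window from `[0, T]` to `[t, T + t]`; the two windows
differ by two pieces of length `t`, whatever `T` is. Dividing by `T` yields invariance of limits of
occupation measures. -/
lemma IsFellerProcess.abs_integral_semigroup_sub_le [IsMarkovKernel P]
    (hV : IsFellerProcess ℱ P V) (x : S) (T : ℝ) {k : S → ℝ} (hk : Continuous k)
    {M : ℝ} (hM : ∀ y, |k y| ≤ M) (t : ℝ≥0) (hT : 0 ≤ T) :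
    |(∫ s in (0 : ℝ)..T, semigroup P V s.toNNReal (semigroup P V t k) x) -
      ∫ s in (0 : ℝ)..T, semigroup P V s.toNNReal k x| ≤ 2 * M * t := by
  have h1 : ∫ s in (0 : ℝ)..T, semigroup P V s.toNNReal (semigroup P V t k) x =
      ∫ s in (0 : ℝ)..T, semigroup P V (s + t).toNNReal k x := by
    refine intervalIntegral.integral_congr fun s hs => ?_
    rw [Set.uIcc_of_le hT] at hs
    rw [Real.toNNReal_add hs.1 t.coe_nonneg, Real.toNNReal_coe, hV.semigroup_add hk]
  have hi := hV.intervalIntegrable_semigroup hk x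
  rw [h1, intervalIntegral.integral_comp_add_right (fun s => semigroup P V s.toNNReal k x),
    intervalIntegral.integral_interval_sub_interval_comm (hi _ _) (hi _ _) (hi _ _)]
  have hb : ∀ a, |∫ s in a..a + t, semigroup P V s.toNNReal k x| ≤ M * t := fun a => by
    have := intervalIntegral.norm_integral_le_of_norm_le_const (a := a) (b := a + t)
      (f := fun s => semigroup P V s.toNNReal k x) (C := M) (fun s _ => abs_semigroup_le hM _ _)
    simpa using this
  have h2 := hb 0
  have h3 := hb T
  rw [intervalIntegral.integral_symm 0 (0 + (t : ℝ)), intervalIntegral.integral_symm T (T + (t : ℝ))]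
  rw [abs_le] at *
  constructor <;> linarith [h2.1, h2.2, h3.1, h3.2]

/-- A Feller process on a compact space with a unique invariant probability measure is uniformly
ergodic in mean. -/
theorem IsFellerProcess.uniform_ergodic [IsMarkovKernel P] (hV : IsFellerProcess ℱ P V)
    {π : Measure S} (hπ : ∀ μ : Measure S, IsProbabilityMeasure μ → IsInvariant P V μ → μ = π)
    {h : S → ℝ} (hh : Continuous h) (h0 : ∫ y, h y ∂π = 0) {η : ℝ} (hη : 0 < η) :
    ∃ τ₀ : ℝ, 0 < τ₀ ∧ ∀ τ, τ₀ ≤ τ → ∀ x,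
      |∫ s in (0 : ℝ)..τ, semigroup P V s.toNNReal h x| ≤ η * τ := by
  by_contra! H
  choose T hT x hx using fun n : ℕ => H (n + 1) (by positivity)
  have hTpos : ∀ n, 0 < T n := fun n => lt_of_lt_of_le (by positivity) (hT n)
  have hTtop : Tendsto T atTop atTop :=
    tendsto_atTop_mono (fun n => (by linarith [hT n] : (n : ℝ) ≤ T n)) tendsto_natCast_atTop_atTop
  let ν : ℕ → ProbabilityMeasure S := fun n =>
    ⟨occupation P V (x n) (T n), hV.isProbabilityMeasure_occupation _ (hTpos n)⟩
  -- Failure of the claim gives times `T n → ∞` and starting points `x n` with large averages;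
  -- probability measures on a compact space are weakly sequentially compact.
  obtain ⟨μ, φ, hφ, hμ⟩ := CompactSpace.tendsto_subseq ν
  have hlim : ∀ k : S → ℝ, Continuous k → Tendsto (fun n => (T (φ n))⁻¹ *
      ∫ s in (0 : ℝ)..T (φ n), semigroup P V s.toNNReal k (x (φ n))) atTop
      (𝓝 (∫ y, k y ∂(μ : Measure S))) := fun k hk => by
    have := ProbabilityMeasure.tendsto_iff_forall_integral_tendsto.1 hμ
      (BoundedContinuousFunction.mkOfCompact ⟨k, hk⟩)
    refine this.congr fun n => ?_
    exact hV.integral_occupation _ (hTpos _) hk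
  have hinv : IsInvariant P V (μ : Measure S) := fun t => by
    have := Measure.isProbabilityMeasure_map (μ := startLaw P (μ : Measure S))
      (hV.measurable t).aemeasurable
    refine ext_of_forall_integral_eq_of_IsFiniteMeasure fun k => ?_
    rw [integral_map (hV.measurable t).aemeasurable k.continuous.aestronglyMeasurable,
      hV.integral_startLaw_comp k.continuous]
    -- The Feller property makes `semigroup P V t k` an admissible test function for weak
    -- convergence.
    refine sub_eq_zero.1 (tendsto_nhds_unique
      ((hlim _ (hV.continuous_semigroup t k.continuous)).sub (hlim k k.continuous)) ?_)
    obtain ⟨M, -, hM⟩ := exists_abs_le_of_continuous k.continuous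
    refine squeeze_zero_norm (a := fun n => (T (φ n))⁻¹ * (2 * M * t)) (fun n => ?_) ?_
    · rw [← mul_sub, norm_mul, Real.norm_of_nonneg (inv_nonneg.2 (hTpos _).le)]
      exact mul_le_mul_of_nonneg_left
        (hV.abs_integral_semigroup_sub_le _ _ k.continuous hM t (hTpos _).le)
        (inv_nonneg.2 (hTpos _).le)
    · simpa using ((hTtop.comp hφ.tendsto_atTop).inv_tendsto_atTop).mul_const (2 * M * (t : ℝ))
  have h1 := (hlim h hh).abs
  rw [hπ _ inferInstance hinv, h0, abs_zero] at h1
  -- The absolute averages tend to `|∫ h dπ| = 0`, yet each exceeds `η`.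
  refine absurd (ge_of_tendsto h1 (b := η) (Eventually.of_forall fun n => ?_)) (not_le.2 hη)
  have hp := hTpos (φ n)
  rw [abs_mul, abs_of_pos (inv_pos.2 hp), inv_mul_eq_div, le_div_iff₀ hp]
  exact (hx (φ n)).le

end Markov

/-! ### Interval integrals depending on a parameter. -/

section Fubini

variable {X : Type*} [MeasurableSpace X] {μ : Measure X} [IsFiniteMeasure μ] {F : ℝ → X → ℝ}
  {M : ℝ}

lemma integral_intervalIntegral_swap (hF : Measurable (Function.uncurry F))
    (hM : ∀ s x, |F s x| ≤ M) (a b : ℝ) :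
    ∫ x, (∫ s in a..b, F s x) ∂μ = ∫ s in a..b, ∫ x, F s x ∂μ := by
  have h : ∀ a b : ℝ, ∫ x, (∫ s in Set.Ioc a b, F s x) ∂μ = ∫ s in Set.Ioc a b, ∫ x, F s x ∂μ :=
    fun a b => by
    refine (integral_integral_swap ?_).symm
    exact Integrable.of_bound hF.aestronglyMeasurable M (ae_of_all _ fun p => hM _ _)
  rcases le_total a b with hab | hab
  · simp_rw [intervalIntegral.integral_of_le hab]
    exact h a b
  · simp_rw [intervalIntegral.integral_of_ge hab, integral_neg, h]

lemma measurable_intervalIntegral (hF : Measurable (Function.uncurry F)) (a b : ℝ) :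
    Measurable fun x => ∫ s in a..b, F s x := by
  have h : ∀ a b : ℝ, Measurable fun x => ∫ s in Set.Ioc a b, F s x := fun a b =>
    (hF.stronglyMeasurable.integral_prod_left' (μ := volume.restrict (Set.Ioc a b))).measurable
  exact (h a b).sub (h b a)

lemma abs_intervalIntegral_le {G : ℝ → ℝ} (hM : ∀ s, |G s| ≤ M) (a b : ℝ) :
    |∫ s in a..b, G s| ≤ M * |b - a| := by
  simpa using intervalIntegral.norm_integral_le_of_norm_le_const (a := a) (b := b)
      (f := G) (C := M) (fun s _ => hM s)

lemma intervalIntegrable_of_measurable_of_bound {G : ℝ → ℝ} (hG : Measurable G)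
    (hM : ∀ s, |G s| ≤ M) (a b : ℝ) : IntervalIntegrable G volume a b :=
  intervalIntegrable_const (c := M) |>.mono_fun hG.aestronglyMeasurable
    (ae_of_all _ fun s => (hM s).trans (le_abs_self M))

end Fubini

/-! ### Second moments and the `L¹` ergodic theorem. -/

section Ergodic

variable {S : Type u} [TopologicalSpace S] [PolishSpace S] [CompactSpace S]
    [MeasurableSpace S] [BorelSpace S] {Ω : Type v} {mΩ : MeasurableSpace Ω}
    {ℱ : Filtration ℝ≥0 mΩ} {P : Kernel S Ω} {V : ℝ≥0 → Ω → S} {π : Measure S}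

/-- Two-point correlations of the stationary process. -/
lemma IsFellerProcess.integral_startLaw_mul_comp [IsMarkovKernel P] [IsProbabilityMeasure π]
    (hV : IsFellerProcess ℱ P V) (hπ : IsInvariant P V π)
    {h k : S → ℝ} (hh : Continuous h) (hk : Continuous k) (r t : ℝ≥0) :
    ∫ ω, h (V r ω) * k (V (r + t) ω) ∂(startLaw P π) = ∫ x, h x * semigroup P V t k x ∂π := by
  have hc : Continuous fun x => h x * semigroup P V t k x := hh.mul (hV.continuous_semigroup t hk)
  have hi : Integrable (fun ω => h (V r ω) * k (V (r + t) ω)) (startLaw P π) := by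
    obtain ⟨N, -, hN⟩ := exists_abs_le_of_continuous hh
    exact (hV.integrable_comp hk _).bdd_mul
      (hh.measurable.comp (hV.measurable r)).aestronglyMeasurable (ae_of_all _ fun ω => hN _)
  rw [integral_startLaw hi]
  simp_rw [hV.integral_mul_comp hh hk]
  rw [← integral_startLaw (hV.integrable_comp hc r)]
  -- Invariance replaces `π` by the law of `V r`, which removes the dependence on `r`.
  conv_rhs => rw [← hπ r]
  rw [integral_map (hV.measurable r).aemeasurable hc.aestronglyMeasurable]

variable {h : S → ℝ} {M η C : ℝ}

/-- By Fubini the time integral falls on the semigroup alone, where `hB` applies for each `x`. Only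
averaged correlations need to be small, not the correlations themselves. -/
lemma IsFellerProcess.abs_intervalIntegral_correlation_le [IsMarkovKernel P]
    [IsProbabilityMeasure π] (hV : IsFellerProcess ℱ P V) (hh : Continuous h)
    (hM : ∀ y, |h y| ≤ M) {τ B : ℝ}
    (hB : ∀ x, |∫ s in (0 : ℝ)..τ, semigroup P V s.toNNReal h x| ≤ B) :
    |∫ s in (0 : ℝ)..τ, ∫ x, h x * semigroup P V s.toNNReal h x ∂π| ≤ M * B := by
  rw [← integral_intervalIntegral_swap (M := M * M)]
  · simp_rw [intervalIntegral.integral_const_mul]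
    have := norm_integral_le_of_norm_le_const (μ := π) (C := M * B)
      (f := fun x => h x * ∫ s in (0 : ℝ)..τ, semigroup P V s.toNNReal h x)
      (ae_of_all _ fun x => by
        rw [norm_mul]
        exact mul_le_mul (hM x) (hB x) (norm_nonneg _) ((abs_nonneg _).trans (hM x)))
    simpa using this
  · exact (hh.measurable.comp measurable_snd).mul (hV.measurable_semigroup hh)
  · intro s x
    rw [abs_mul]
    exact mul_le_mul (hM x) (abs_semigroup_le hM _ _) (abs_nonneg _) ((abs_nonneg _).trans (hM x))

lemma IsFellerProcess.measurable_real_comp (hV : IsFellerProcess ℱ P V) (hh : Continuous h) :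
    Measurable (Function.uncurry fun (s : ℝ) (ω : Ω) => h (V s.toNNReal ω)) :=
  hh.measurable.comp hV.measurable_real

/-- The second moment of an additive functional of the stationary process. -/
lemma IsFellerProcess.integral_sq_intervalIntegral_le [IsMarkovKernel P] [IsProbabilityMeasure π]
    (hV : IsFellerProcess ℱ P V) (hπ : IsInvariant P V π) (hh : Continuous h)
    (hM : ∀ y, |h y| ≤ M) (hM0 : 0 ≤ M)
    (hB : ∀ τ, 0 ≤ τ → ∀ x, |∫ s in (0 : ℝ)..τ, semigroup P V s.toNNReal h x| ≤ η * τ + C)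
    {T : ℝ} (hT : 0 ≤ T) :
    ∫ ω, (∫ s in (0 : ℝ)..T, h (V s.toNNReal ω)) ^ 2 ∂(startLaw P π) ≤
      M * (η * T + 2 * C) * T := by
  have hm := hV.measurable_real_comp hh
  have hmul : ∀ x y, |h x * h y| ≤ M * M := fun x y => by
    rw [abs_mul]; exact mul_le_mul (hM x) (hM y) (abs_nonneg _) hM0
  let c : ℝ → ℝ := fun t => ∫ x, h x * semigroup P V t.toNNReal h x ∂π
  have hcorr : ∀ r u : ℝ, 0 ≤ r → r ≤ u →
      ∫ ω, h (V r.toNNReal ω) * h (V u.toNNReal ω) ∂(startLaw P π) = c (u - r) :=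
    fun r u hr hu => by
    have := hV.integral_startLaw_mul_comp hπ hh hh r.toNNReal (u - r).toNNReal
    rwa [← Real.toNNReal_add hr (sub_nonneg.2 hu), add_sub_cancel] at this
  have hcB : ∀ τ, 0 ≤ τ → |∫ s in (0 : ℝ)..τ, c s| ≤ M * (η * τ + C) := fun τ hτ =>
    hV.abs_intervalIntegral_correlation_le hh hM (hB τ hτ)
  -- Splitting at `u = r` gives integrals of `c` over lengths `r` and `T - r`: the `η` terms add up
  -- to `η * T`, while `C` appears twice.
  have key : ∀ r ∈ Set.Icc 0 T, |∫ ω, h (V r.toNNReal ω) *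
      (∫ u in (0 : ℝ)..T, h (V u.toNNReal ω)) ∂(startLaw P π)| ≤ M * (η * T + 2 * C) := by
    rintro r ⟨hr0, hrT⟩
    simp_rw [← intervalIntegral.integral_const_mul]
    rw [integral_intervalIntegral_swap (M := M * M)
      (((hh.measurable.comp (hV.measurable _)).comp measurable_snd).mul hm)
      (fun s ω => hmul _ _)]
    have e1 : Set.EqOn (fun u : ℝ => ∫ ω, h (V r.toNNReal ω) * h (V u.toNNReal ω) ∂(startLaw P π))
        (fun u => c (r - u)) (Set.uIcc 0 r) := fun u hu => by
      rw [Set.uIcc_of_le hr0] at hu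
      refine Eq.trans ?_ (hcorr u r hu.1 hu.2)
      exact integral_congr_ae (ae_of_all _ fun ω => mul_comm _ _)
    have e2 : Set.EqOn (fun u : ℝ => ∫ ω, h (V r.toNNReal ω) * h (V u.toNNReal ω) ∂(startLaw P π))
        (fun u => c (u - r)) (Set.uIcc r T) := fun u hu => by
      rw [Set.uIcc_of_le hrT] at hu
      exact hcorr r u hr0 hu.1
    have hi : ∀ a b : ℝ, IntervalIntegrable
        (fun u : ℝ => ∫ ω, h (V r.toNNReal ω) * h (V u.toNNReal ω) ∂(startLaw P π)) volume a b := by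
      refine fun a b => intervalIntegrable_of_measurable_of_bound (M := M * M) ?_ ?_ a b
      · have : Measurable fun p : ℝ × Ω => h (V r.toNNReal p.2) * h (V p.1.toNNReal p.2) :=
          ((hh.measurable.comp (hV.measurable _)).comp measurable_snd).mul hm
        exact (this.stronglyMeasurable.integral_prod_right' (ν := startLaw P π)).measurable
      · intro s
        have := norm_integral_le_of_norm_le_const (μ := startLaw P π) (C := M * M)
          (f := fun ω => h (V r.toNNReal ω) * h (V s.toNNReal ω)) (ae_of_all _ fun x => hmul _ _)
        simpa using this
    rw [← intervalIntegral.integral_add_adjacent_intervals (hi 0 r) (hi r T),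
      intervalIntegral.integral_congr e1, intervalIntegral.integral_congr e2,
      intervalIntegral.integral_comp_sub_left c, intervalIntegral.integral_comp_sub_right c,
      sub_self, sub_zero]
    have b1 := hcB r hr0
    have b2 := hcB (T - r) (sub_nonneg.2 hrT)
    calc _ ≤ _ := abs_add_le _ _
      _ ≤ M * (η * r + C) + M * (η * (T - r) + C) := add_le_add b1 b2
      _ = _ := by ring
  have hsq : ∀ ω, (∫ s in (0 : ℝ)..T, h (V s.toNNReal ω)) ^ 2 =
      ∫ r in (0 : ℝ)..T, h (V r.toNNReal ω) * ∫ u in (0 : ℝ)..T, h (V u.toNNReal ω) := fun ω => by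
    rw [intervalIntegral.integral_mul_const, sq]
  have hZ : ∀ ω, |∫ u in (0 : ℝ)..T, h (V u.toNNReal ω)| ≤ M * |T - 0| := fun ω =>
    abs_intervalIntegral_le (fun s => hM _) 0 T
  simp_rw [hsq]
  rw [integral_intervalIntegral_swap (M := M * (M * |T - 0|))]
  · have := intervalIntegral.norm_integral_le_of_norm_le_const (a := 0) (b := T)
      (C := M * (η * T + 2 * C)) (f := fun r : ℝ => ∫ ω, h (V r.toNNReal ω) *
        (∫ u in (0 : ℝ)..T, h (V u.toNNReal ω)) ∂(startLaw P π)) (fun r hr => key r (by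
          rw [Set.uIoc_of_le hT] at hr; exact ⟨hr.1.le, hr.2⟩))
    rw [sub_zero, abs_of_nonneg hT] at this
    exact (le_abs_self _).trans this
  · exact hm.mul ((measurable_intervalIntegral hm 0 T).comp measurable_snd)
  · intro s ω
    rw [abs_mul]
    exact mul_le_mul (hM _) (hZ ω) (abs_nonneg _) hM0

/-- Mean ergodic theorem in `L¹` for the rescaled stationary process. -/
theorem IsFellerProcess.tendsto_integral_abs_intervalIntegral [IsMarkovKernel P]
    [IsProbabilityMeasure π] (hV : IsFellerProcess ℱ P V) (hπ : IsInvariant P V π)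
    (huniq : ∀ μ : Measure S, IsProbabilityMeasure μ → IsInvariant P V μ → μ = π)
    (hh : Continuous h) (h0 : ∫ y, h y ∂π = 0) {b : ℝ} (hb : 0 ≤ b) :
    Tendsto (fun ε : ℝ => ∫ ω, |∫ s in (0 : ℝ)..b, h (V (s / ε).toNNReal ω)| ∂(startLaw P π))
      (𝓝[>] 0) (𝓝 0) := by
  obtain ⟨M, hM0, hM⟩ := exists_abs_le_of_continuous hh
  have hm := hV.measurable_real_comp hh
  -- Cauchy–Schwarz and the substitution `s ↦ s / ε`
  have hbound : ∀ η > 0, ∃ C : ℝ, ∀ ε > 0,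
      (∫ ω, |∫ s in (0 : ℝ)..b, h (V (s / ε).toNNReal ω)| ∂(startLaw P π)) ^ 2 ≤
        M * b ^ 2 * η + ε * C := by
    intro η hη
    obtain ⟨τ₀, hτ₀, hτ⟩ := hV.uniform_ergodic huniq hh h0 hη
    -- This is the second term of `ε² · M(η b/ε + 2Mτ₀)(b/ε)`, divided by `ε`. The constant `M * τ₀`
    -- covers times shorter than `τ₀`, where only the trivial bound is available.
    refine ⟨2 * M * (M * τ₀) * b, fun ε hε => ?_⟩
    have hB : ∀ τ, 0 ≤ τ → ∀ x,
        |∫ s in (0 : ℝ)..τ, semigroup P V s.toNNReal h x| ≤ η * τ + M * τ₀ := fun τ h1 x => by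
      rcases le_total τ₀ τ with h2 | h2
      · exact (hτ τ h2 x).trans (le_add_of_nonneg_right (by positivity))
      · refine (abs_intervalIntegral_le (fun s => abs_semigroup_le hM _ x) 0 τ).trans ?_
        rw [sub_zero, abs_of_nonneg h1]
        exact (mul_le_mul_of_nonneg_left h2 hM0).trans (le_add_of_nonneg_left (by positivity))
    have hsq := hV.integral_sq_intervalIntegral_le hπ hh hM hM0 hB (T := b / ε) (by positivity)
    have hsub : ∀ ω, ∫ s in (0 : ℝ)..b, h (V (s / ε).toNNReal ω) =
        ε * ∫ s in (0 : ℝ)..b / ε, h (V s.toNNReal ω) := fun ω => by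
      rw [intervalIntegral.integral_comp_div (fun s => h (V s.toNNReal ω)) hε.ne', zero_div,
        smul_eq_mul]
    simp_rw [hsub, abs_mul, integral_const_mul, abs_of_pos hε, mul_pow]
    set Z : Ω → ℝ := fun ω => ∫ s in (0 : ℝ)..b / ε, h (V s.toNNReal ω) with hZ
    have hZm : Measurable Z := measurable_intervalIntegral hm 0 _
    have hZb : ∀ ω, |Z ω| ≤ M * |b / ε - 0| := fun ω =>
      abs_intervalIntegral_le (fun s => hM _) _ _
    have hZ2 : MemLp Z 2 (startLaw P π) :=
      MemLp.of_bound hZm.aestronglyMeasurable _ (ae_of_all _ hZb)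
    -- Cauchy–Schwarz, as nonnegativity of the variance of `|Z|`.
    have hcs : (∫ ω, |Z ω| ∂(startLaw P π)) ^ 2 ≤ ∫ ω, Z ω ^ 2 ∂(startLaw P π) := by
      have h1 := variance_nonneg |Z| (startLaw P π)
      rw [variance_eq_sub hZ2.abs] at h1
      simpa [sq_abs] using h1
    calc ε ^ 2 * (∫ ω, |Z ω| ∂(startLaw P π)) ^ 2
        ≤ ε ^ 2 * (M * (η * (b / ε) + 2 * (M * τ₀)) * (b / ε)) := by gcongr; exact hcs.trans hsq
      _ = _ := by field_simp
  have hnn : ∀ ε : ℝ, 0 ≤ ∫ ω, |∫ s in (0 : ℝ)..b, h (V (s / ε).toNNReal ω)| ∂(startLaw P π) :=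
    fun ε => integral_nonneg fun ω => abs_nonneg _
  refine Metric.tendsto_nhds.2 fun e he => ?_
  -- Chosen so that `M b² η ≤ e²/2`; the `+ 1` keeps the denominator positive when `M b² = 0`.
  obtain ⟨C, hC⟩ := hbound (e ^ 2 / (2 * (M * b ^ 2 + 1))) (by positivity)
  have hlim : Tendsto (fun ε : ℝ => ε * C) (𝓝[>] 0) (𝓝 0) := by
    have : Tendsto (fun ε : ℝ => ε * C) (𝓝 0) (𝓝 (0 * C)) := tendsto_id.mul_const C
    rw [zero_mul] at this
    exact this.mono_left nhdsWithin_le_nhds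
  filter_upwards [hlim.eventually (gt_mem_nhds (show 0 < e ^ 2 / 2 by positivity)),
    self_mem_nhdsWithin] with ε h1 h2
  rw [Real.dist_eq, sub_zero, abs_of_nonneg (hnn ε)]
  refine lt_of_pow_lt_pow_left₀ 2 he.le ((hC ε h2).trans_lt ?_)
  have h3 : M * b ^ 2 * (e ^ 2 / (2 * (M * b ^ 2 + 1))) ≤ e ^ 2 / 2 := by
    rw [mul_div_assoc', div_le_div_iff₀ (by positivity) (by positivity)]
    nlinarith [sq_nonneg e]
  linarith

end Ergodic

/-- Grönwall's inequality in integral form. -/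
lemma le_mul_exp_of_le_add_integral {u : ℝ → ℝ} (hu : Continuous u) (hu0 : ∀ t, 0 ≤ u t)
    {B L T : ℝ} (h : ∀ t ∈ Set.Icc 0 T, u t ≤ B + L * ∫ s in (0 : ℝ)..t, u s) (hL : 0 < L) :
    ∀ t ∈ Set.Icc 0 T, u t ≤ B * Real.exp (L * t) := by
  intro t ht
  have hd : ∀ x, HasDerivAt (fun t => ∫ s in (0 : ℝ)..t, u s) (u x) x := fun x =>
    intervalIntegral.integral_hasDerivAt_right (hu.intervalIntegrable _ _)
      hu.stronglyMeasurable.stronglyMeasurableAtFilter hu.continuousAt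
  -- The differential form of Grönwall is applied to the primitive `w` of `u`, which satisfies `w' ≤
  -- B + L w`; the bound on `w` is then put back into `h`.
  have hw := norm_le_gronwallBound_of_norm_deriv_right_le (f := fun t => ∫ s in (0 : ℝ)..t, u s)
    (f' := u) (δ := 0) (K := L) (ε := B) (a := 0) (b := T)
    (fun x _ => (hd x).continuousAt.continuousWithinAt) (fun x _ => (hd x).hasDerivWithinAt)
    (by simp) (fun x hx => by
      have h0 : 0 ≤ ∫ s in (0 : ℝ)..x, u s :=
        intervalIntegral.integral_nonneg hx.1 fun s _ => hu0 s
      rw [Real.norm_of_nonneg (hu0 x), Real.norm_of_nonneg h0, add_comm]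
      exact h x ⟨hx.1, hx.2.le⟩) t ht
  have hw' := (le_abs_self _).trans hw
  rw [gronwallBound_of_K_ne_0 hL.ne'] at hw'
  simp only [zero_mul, zero_add, sub_zero] at hw'
  calc u t ≤ B + L * ∫ s in (0 : ℝ)..t, u s := h t ht
    _ ≤ B + L * (B / L * (Real.exp (L * t) - 1)) := by gcongr
    _ = _ := by field_simp; ring

/-! ### Pathwise estimates for a fixed driving path. -/

section Path

variable {S : Type u} [TopologicalSpace S] [PolishSpace S] [CompactSpace S]
    [MeasurableSpace S] [BorelSpace S] {E : Type*} [NormedAddCommGroup E] [NormedSpace ℝ E]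
    {y : ℝ → S}

lemma intervalIntegrable_comp_path (hy : Measurable y) {G : ℝ → S → E}
    (hG : Continuous (Function.uncurry G)) (a b : ℝ) :
    IntervalIntegrable (fun s => G s (y s)) volume a b := by
  obtain ⟨M, hM⟩ := (isCompact_uIcc (a := a) (b := b)).prod (isCompact_univ (X := S))
    |>.exists_bound_of_continuousOn hG.continuousOn
  have hm : StronglyMeasurable fun s => G s (y s) :=
    hG.comp_stronglyMeasurable (measurable_id.prodMk hy).stronglyMeasurable
  refine (intervalIntegrable_const (c := M)).mono_fun hm.aestronglyMeasurable ?_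
  filter_upwards [ae_restrict_mem measurableSet_uIoc] with s hs
  exact (hM (s, y s) ⟨Set.uIoc_subset_uIcc hs, trivial⟩).trans (le_abs_self M)

/-- Comparison of a driven ordinary differential equation with its averaged equation. -/
lemma norm_sub_le_mul_exp (hy : Measurable y) {g : E → S → E}
    (hg : Continuous (Function.uncurry g)) {L : ℝ} (hL : 0 < L)
    (hgL : ∀ x x' v, ‖g x v - g x' v‖ ≤ L * ‖x - x'‖)
    {G : E → E} (hG : Continuous G) {θ ζ : ℝ → E} (hθ : Continuous θ) (hζ : Continuous ζ) {θ₀ : E}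
    {T B : ℝ} (hθe : ∀ t ∈ Set.Icc 0 T, θ t = θ₀ - ∫ s in (0 : ℝ)..t, g (θ s) (y s))
    (hζe : ∀ t ∈ Set.Icc 0 T, ζ t = θ₀ - ∫ s in (0 : ℝ)..t, G (ζ s))
    (hB : ∀ t ∈ Set.Icc 0 T, ‖∫ s in (0 : ℝ)..t, (g (ζ s) (y s) - G (ζ s))‖ ≤ B) :
    ∀ t ∈ Set.Icc 0 T, ‖θ t - ζ t‖ ≤ B * Real.exp (L * t) := by
  refine le_mul_exp_of_le_add_integral (hθ.sub hζ).norm (fun _ => norm_nonneg _) ?_ hL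
  intro t ht
  simp only [Pi.sub_apply]
  have i1 := intervalIntegrable_comp_path (G := fun s v => g (θ s) v) hy
    (hg.comp ((hθ.comp continuous_fst).prodMk continuous_snd)) 0 t
  have i2 := intervalIntegrable_comp_path (G := fun s v => g (ζ s) v) hy
    (hg.comp ((hζ.comp continuous_fst).prodMk continuous_snd)) 0 t
  have i3 : IntervalIntegrable (fun s => G (ζ s)) volume 0 t :=
    (hG.comp hζ).intervalIntegrable _ _
  -- The fluctuation is evaluated along `ζ`, not `θ`: in the application `ζ` is deterministic, so
  -- the ergodic theorem applies to it. The remainder is Lipschitz in `θ - ζ`.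
  have e : θ t - ζ t = -((∫ s in (0 : ℝ)..t, (g (ζ s) (y s) - G (ζ s))) +
      ∫ s in (0 : ℝ)..t, (g (θ s) (y s) - g (ζ s) (y s))) := by
    rw [hθe t ht, hζe t ht, intervalIntegral.integral_sub i2 i3,
      intervalIntegral.integral_sub i1 i2]
    abel
  rw [e, norm_neg]
  refine (norm_add_le _ _).trans (add_le_add (hB t ht) ?_)
  rw [← intervalIntegral.integral_const_mul]
  refine intervalIntegral.norm_integral_le_of_norm_le ht.1 (ae_of_all _ fun s _ => hgL _ _ _) ?_
  exact ((hθ.sub hζ).norm.const_mul L).intervalIntegrable _ _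

/-- Freezing the slow variable on a grid of mesh `Δ`. -/
lemma norm_integral_le_sum_grid (hy : Measurable y) {H : ℝ → S → E}
    (hH : Continuous (Function.uncurry H)) {M η Δ : ℝ} {N : ℕ} (hΔ : 0 < Δ)
    (hM : ∀ u ∈ Set.Icc 0 (N * Δ), ∀ v, ‖H u v‖ ≤ M)
    (hη : ∀ u ∈ Set.Icc 0 (N * Δ), ∀ t ∈ Set.Icc 0 (N * Δ), |u - t| ≤ Δ →
      ∀ v, ‖H u v - H t v‖ ≤ η) {s : ℝ} (hs : s ∈ Set.Icc 0 (N * Δ)) :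
    ‖∫ u in (0 : ℝ)..s, H u (y u)‖ ≤
      ∑ i ∈ Finset.range N, ‖∫ u in (i * Δ)..((i + 1 : ℕ) * Δ), H (i * Δ) (y u)‖ +
        (η * (N * Δ) + M * Δ) := by
  have hi := intervalIntegrable_comp_path hy hH
  have hi' : ∀ r a b : ℝ, IntervalIntegrable (fun u => H r (y u)) volume a b := fun r =>
    intervalIntegrable_comp_path (G := fun _ v => H r v) hy
      (hH.comp (continuous_const.prodMk continuous_snd))
  set j := ⌊s / Δ⌋₊ with hj
  have hj1 : j * Δ ≤ s := (le_div_iff₀ hΔ).1 (Nat.floor_le (div_nonneg hs.1 hΔ.le))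
  have hj2 : s < (j + 1) * Δ := (div_lt_iff₀ hΔ).1 (Nat.lt_floor_add_one _)
  have hjN : j ≤ N := Nat.floor_le_of_le ((div_le_iff₀ hΔ).2 hs.2)
  have hM0 : 0 ≤ M := (norm_nonneg _).trans (hM s hs (y s))
  have h1 : ∀ i ∈ Finset.range N, ‖∫ u in (i * Δ)..((i + 1 : ℕ) * Δ), H u (y u)‖ ≤
      ‖∫ u in (i * Δ)..((i + 1 : ℕ) * Δ), H (i * Δ) (y u)‖ + η * Δ := fun i hi0 => by
    have hiN : ((i + 1 : ℕ) : ℝ) * Δ ≤ N * Δ := by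
      gcongr; exact_mod_cast Finset.mem_range.1 hi0
    have hle : (i : ℝ) * Δ ≤ ((i + 1 : ℕ) : ℝ) * Δ := by gcongr; simp
    have e : ∫ u in (i * Δ)..((i + 1 : ℕ) * Δ), H u (y u) =
        (∫ u in (i * Δ)..((i + 1 : ℕ) * Δ), H (i * Δ) (y u)) +
        ∫ u in (i * Δ)..((i + 1 : ℕ) * Δ), (H u (y u) - H (i * Δ) (y u)) := by
      rw [intervalIntegral.integral_sub (hi _ _) (hi' _ _ _)]; abel
    have hlen : ((i + 1 : ℕ) : ℝ) * Δ - i * Δ = Δ := by push_cast; ring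
    rw [e]
    refine (norm_add_le _ _).trans (add_le_add_right ?_ _)
    have := intervalIntegral.norm_integral_le_of_norm_le_const (a := i * Δ)
      (b := (i + 1 : ℕ) * Δ) (C := η) (f := fun u => H u (y u) - H (i * Δ) (y u)) (fun u hu => by
        rw [Set.uIoc_of_le hle] at hu
        have h0 : (0 : ℝ) ≤ i * Δ := by positivity
        refine hη u ⟨h0.trans hu.1.le, hu.2.trans hiN⟩ _ ⟨h0, hle.trans hiN⟩ ?_ _
        rw [abs_of_nonneg (sub_nonneg.2 hu.1.le)]
        linarith [hu.2])
    rwa [hlen, abs_of_pos hΔ] at this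
  have h2 : ∫ u in (0 : ℝ)..s, H u (y u) =
      ∑ i ∈ Finset.range j, (∫ u in (i * Δ)..((i + 1 : ℕ) * Δ), H u (y u)) +
        ∫ u in (j * Δ)..s, H u (y u) := by
    rw [intervalIntegral.sum_integral_adjacent_intervals (a := fun i : ℕ => (i : ℝ) * Δ)
      (fun k _ => hi _ _), Nat.cast_zero, zero_mul,
      intervalIntegral.integral_add_adjacent_intervals (hi _ _) (hi _ _)]
  have h3 : ‖∫ u in (j * Δ)..s, H u (y u)‖ ≤ M * Δ := by
    have := intervalIntegral.norm_integral_le_of_norm_le_const (a := j * Δ) (b := s) (C := M)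
      (f := fun u => H u (y u)) (fun u hu => by
        rw [Set.uIoc_of_le hj1] at hu
        exact hM u ⟨(by positivity : (0 : ℝ) ≤ j * Δ).trans hu.1.le, hu.2.trans hs.2⟩ _)
    refine this.trans (mul_le_mul_of_nonneg_left ?_ hM0)
    rw [abs_of_nonneg (sub_nonneg.2 hj1)]
    linarith
  -- Extending the sum to all `N` cells makes the bound independent of `s`; the incomplete last cell
  -- costs `M * Δ`.
  have h4 : ∑ i ∈ Finset.range j, ‖∫ u in (i * Δ)..((i + 1 : ℕ) * Δ), H u (y u)‖ ≤
      ∑ i ∈ Finset.range N, ‖∫ u in (i * Δ)..((i + 1 : ℕ) * Δ), H u (y u)‖ :=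
    Finset.sum_le_sum_of_subset_of_nonneg (Finset.range_subset_range.2 hjN)
      fun _ _ _ => norm_nonneg _
  have h5 := Finset.sum_le_sum h1
  rw [Finset.sum_add_distrib, Finset.sum_const, Finset.card_range, nsmul_eq_mul] at h5
  rw [h2]
  calc _ ≤ _ := norm_add_le _ _
    _ ≤ _ := add_le_add ((norm_sum_le _ _).trans (h4.trans h5)) h3
    _ = _ := by ring

end Path

/-! ### Averaging a time-dependent centred integrand. -/

section Averaging

variable {S : Type u} [TopologicalSpace S] [PolishSpace S] [CompactSpace S]
    [MeasurableSpace S] [BorelSpace S] {Ω : Type v} {mΩ : MeasurableSpace Ω}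
    {ℱ : Filtration ℝ≥0 mΩ} {P : Kernel S Ω} {V : ℝ≥0 → Ω → S} {π : Measure S} {K : ℕ}

lemma IsFellerProcess.measurable_path (hV : IsFellerProcess ℱ P V) (ε : ℝ) (ω : Ω) :
    Measurable fun s : ℝ => V (s / ε).toNNReal ω :=
  hV.measurable_real.comp ((measurable_id.div_const ε).prodMk measurable_const)

/-- Reduces a vector integral over a grid cell to scalar integrals starting at `0`, the form treated
by the ergodic theorem. -/
lemma IsFellerProcess.norm_intervalIntegral_comp_le (hV : IsFellerProcess ℱ P V)
    {h : S → EuclideanSpace ℝ (Fin K)} (hh : Continuous h) (ε a b : ℝ) (ω : Ω) :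
    ‖∫ s in a..b, h (V (s / ε).toNNReal ω)‖ ≤
      ∑ k, (|∫ s in (0 : ℝ)..b, h (V (s / ε).toNNReal ω) k| +
        |∫ s in (0 : ℝ)..a, h (V (s / ε).toNNReal ω) k|) := by
  have hi := fun a b => intervalIntegrable_comp_path (G := fun _ v => h v) (hV.measurable_path ε ω)
    (hh.comp continuous_snd) a b
  have hcoord : ∀ a b k, (∫ s in a..b, h (V (s / ε).toNNReal ω)) k =
      ∫ s in a..b, h (V (s / ε).toNNReal ω) k := fun a b k =>
    ((EuclideanSpace.proj k : EuclideanSpace ℝ (Fin K) →L[ℝ] ℝ).intervalIntegral_comp_comm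
      (hi a b)).symm
  have hnorm : ∀ z : EuclideanSpace ℝ (Fin K), ‖z‖ ≤ ∑ k, |z k| := fun z => by
    have : z = ∑ k, z k • EuclideanSpace.single k (1 : ℝ) := by
      simpa using ((EuclideanSpace.basisFun (Fin K) ℝ).sum_repr z).symm
    calc ‖z‖ = ‖∑ k, z k • EuclideanSpace.single k (1 : ℝ)‖ := by rw [← this]
      _ ≤ _ := norm_sum_le _ _
      _ = _ := by simp [norm_smul]
  refine (hnorm _).trans (Finset.sum_le_sum fun k _ => ?_)
  rw [← hcoord, ← hcoord, ← intervalIntegral.integral_interval_sub_left (hi 0 b) (hi 0 a),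
    PiLp.sub_apply]
  exact abs_sub _ _

/-- Averaging along the rescaled stationary process, uniformly on compact time intervals. -/
theorem IsFellerProcess.exists_averaging_bound [IsMarkovKernel P]
    [IsProbabilityMeasure π] (hV : IsFellerProcess ℱ P V) (hπ : IsInvariant P V π)
    (huniq : ∀ μ : Measure S, IsProbabilityMeasure μ → IsInvariant P V μ → μ = π)
    {H : ℝ → S → EuclideanSpace ℝ (Fin K)} (hH : Continuous (Function.uncurry H))
    (hH0 : ∀ t, ∫ v, H t v ∂π = 0) {T η : ℝ} (hT : 0 < T) (hη : 0 < η) :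
    ∃ B : ℝ → Ω → ℝ, (∀ ε, Integrable (B ε) (startLaw P π)) ∧
      (∀ ε ω, ∀ s ∈ Set.Icc 0 T, ‖∫ u in (0 : ℝ)..s, H u (V (u / ε).toNNReal ω)‖ ≤ B ε ω + η) ∧
      Tendsto (fun ε => ∫ ω, B ε ω ∂(startLaw P π)) (𝓝[>] 0) (𝓝 0) := by
  have hHt : ∀ t, Continuous (H t) := fun t => hH.comp (continuous_const.prodMk continuous_id)
  obtain ⟨M, hM⟩ := (isCompact_Icc (a := (0 : ℝ)) (b := T)).prod (isCompact_univ (X := S))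
    |>.exists_bound_of_continuousOn hH.continuousOn
  -- Since `S` is compact, currying gives continuity in the sup norm, hence a modulus on `[0, T]`
  -- uniform in `v`.
  let F : C(ℝ, C(S, EuclideanSpace ℝ (Fin K))) := ContinuousMap.curry ⟨Function.uncurry H, hH⟩
  have hF := (isCompact_Icc (a := (0 : ℝ)) (b := T)).uniformContinuousOn_of_continuous
    F.continuous.continuousOn
  obtain ⟨δ, hδ, hF⟩ := Metric.uniformContinuousOn_iff.1 hF (η / (2 * T)) (by positivity)
  -- The two lower bounds on `N` ensure `Δ < δ` and `M * Δ ≤ η / 2`; the freezing error `η / (2 *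
  -- T)` accumulates to the other `η / 2`.
  obtain ⟨N, hN⟩ := exists_nat_gt (max (T / δ) (2 * (|M| + 1) * T / η))
  have hN0 : (0 : ℝ) < N := lt_of_le_of_lt (le_max_of_le_left (by positivity)) hN
  have hN1 := (le_max_left _ _).trans_lt hN
  have hN2 := (le_max_right _ _).trans_lt hN
  set Δ := T / N with hΔ
  have hΔ0 : 0 < Δ := by positivity
  have hNΔ : N * Δ = T := by rw [hΔ]; field_simp
  have hΔδ : Δ < δ := by
    rw [div_lt_iff₀ hδ] at hN1
    rw [hΔ, div_lt_iff₀ hN0]; linarith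
  have hΔM : M * Δ ≤ η / 2 := by
    rw [div_lt_iff₀ hη] at hN2
    have : (|M| + 1) * Δ ≤ η / 2 := by
      rw [hΔ, mul_div_assoc', div_le_iff₀ hN0]; linarith
    nlinarith [le_abs_self M]
  let k : ℕ → ℝ → Fin K → ℝ → Ω → ℝ := fun i b l ε ω =>
    |∫ s in (0 : ℝ)..b, H (i * Δ) (V (s / ε).toNNReal ω) l|
  have hcont : ∀ (i : ℕ) l, Continuous fun v => H (i * Δ) v l := fun i l =>
    (EuclideanSpace.proj l : EuclideanSpace ℝ (Fin K) →L[ℝ] ℝ).continuous.comp (hHt _)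
  have hkint : ∀ i b l ε, Integrable (k i b l ε) (startLaw P π) := fun i b l ε => by
    obtain ⟨M', -, hM'⟩ := exists_abs_le_of_continuous (hcont i l)
    have hm : Measurable (Function.uncurry fun (s : ℝ) ω =>
        H (i * Δ) (V (s / ε).toNNReal ω) l) :=
      (hV.measurable_real_comp (hcont i l)).comp
        ((measurable_fst.div_const ε).prodMk measurable_snd)
    refine Integrable.of_bound
      (measurable_intervalIntegral hm 0 b).abs.aestronglyMeasurable (M' * |b - 0|)
      (ae_of_all _ fun ω => ?_)
    rw [Real.norm_eq_abs, abs_abs]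
    exact abs_intervalIntegral_le (fun s => hM' _) 0 b
  have hkadd : ∀ i b b' l ε, Integrable (fun ω => k i b l ε ω + k i b' l ε ω) (startLaw P π) :=
    fun i b b' l ε => (hkint i b l ε).add (hkint i b' l ε)
  have hklim : ∀ i b l, 0 ≤ b →
      Tendsto (fun ε => ∫ ω, k i b l ε ω ∂(startLaw P π)) (𝓝[>] 0) (𝓝 0) := fun i b l hb => by
    refine hV.tendsto_integral_abs_intervalIntegral hπ huniq (hcont i l) ?_ hb
    have hint : Integrable (H (i * Δ)) π := (hHt _).integrable_of_hasCompactSupport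
      (HasCompactSupport.of_compactSpace _)
    have := (EuclideanSpace.proj l : EuclideanSpace ℝ (Fin K) →L[ℝ] ℝ).integral_comp_comm hint
    rw [hH0, map_zero] at this
    exact this
  refine ⟨fun ε ω => ∑ i ∈ Finset.range N, ∑ l,
    (k i ((i + 1 : ℕ) * Δ) l ε ω + k i (i * Δ) l ε ω), ?_, ?_, ?_⟩
  · exact fun ε => integrable_finsetSum _ fun i _ => integrable_finsetSum _ fun l _ =>
      hkadd _ _ _ _ _
  · intro ε ω s hs
    rw [← hNΔ] at hs
    refine (norm_integral_le_sum_grid (hV.measurable_path ε ω) hH (M := M) (η := η / (2 * T))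
      hΔ0 ?_ ?_ hs).trans ?_
    · exact fun u hu v => hM (u, v) ⟨hNΔ ▸ hu, trivial⟩
    · intro u hu t ht hut v
      rw [hNΔ] at hu ht
      have h1 := hF u hu t ht (by rw [Real.dist_eq]; exact hut.trans_lt hΔδ)
      have h2 := ContinuousMap.dist_apply_le_dist (f := F u) (g := F t) v
      rw [dist_eq_norm] at h2
      exact h2.trans h1.le
    · refine add_le_add (Finset.sum_le_sum fun i _ =>
        hV.norm_intervalIntegral_comp_le (hHt _) _ _ _ _) ?_
      have : η / (2 * T) * (N * Δ) = η / 2 := by rw [hNΔ]; field_simp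
      linarith
  · have hsum : ∀ ε, ∫ ω, ∑ i ∈ Finset.range N, ∑ l,
        (k i ((i + 1 : ℕ) * Δ) l ε ω + k i (i * Δ) l ε ω) ∂(startLaw P π) =
        ∑ i ∈ Finset.range N, ∑ l, ((∫ ω, k i ((i + 1 : ℕ) * Δ) l ε ω ∂(startLaw P π)) +
          ∫ ω, k i (i * Δ) l ε ω ∂(startLaw P π)) := fun ε => by
      rw [integral_finsetSum _ fun i _ => integrable_finsetSum _ fun l _ =>
        hkadd _ _ _ _ _]
      refine Finset.sum_congr rfl fun i _ => ?_
      rw [integral_finsetSum _ fun l _ => hkadd _ _ _ _ _]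
      exact Finset.sum_congr rfl fun l _ => integral_add (hkint _ _ _ _) (hkint _ _ _ _)
    simp_rw [hsum]
    have := tendsto_finsetSum (Finset.range N) fun i _ => tendsto_finsetSum Finset.univ
      fun (l : Fin K) _ => (hklim i ((i + 1 : ℕ) * Δ) l (by positivity)).add
        (hklim i (i * Δ) l (by positivity))
    simpa using this

end Averaging

/-- The product measure is a coupling with a Dirac mass, and its cost is the integral on the right.
-/
lemma wassersteinTrunc_dirac_le {E : Type*} [NormedAddCommGroup E] [MeasurableSpace E]
    [BorelSpace E] [SecondCountableTopology E]
    (ν : Measure E) [IsProbabilityMeasure ν] (z : E) :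
    wassersteinTrunc ν (Measure.dirac z) ≤ ENNReal.ofReal (∫ y, min 1 ‖y - z‖ ∂ν) := by
  refine (iInf₂_le (ν.prod (Measure.dirac z)) ⟨inferInstance, by simp, by simp⟩).trans_eq ?_
  have hm : Measurable fun p : E × E => ENNReal.ofReal (min 1 ‖p.1 - p.2‖) := by fun_prop
  rw [lintegral_prod _ hm.aemeasurable]
  refine (lintegral_congr fun y => lintegral_dirac' z
    (hm.comp (measurable_prodMk_left (x := y)))).trans ?_
  refine (ofReal_integral_eq_lintegral_ofReal ?_ (ae_of_all _ fun y => by positivity)).symm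
  refine Integrable.of_bound (by fun_prop) 1 (ae_of_all _ fun y => ?_)
  rw [Real.norm_of_nonneg (by positivity)]
  exact min_le_left _ _

/-! ### Averaging for the gradient process, and the choice of `α`. -/

section Main

variable {S : Type u} [TopologicalSpace S] [PolishSpace S] [CompactSpace S]
    [MeasurableSpace S] [BorelSpace S] {Ω : Type v} {mΩ : MeasurableSpace Ω}
    {ℱ : Filtration ℝ≥0 mΩ} {P : Kernel S Ω} {V : ℝ≥0 → Ω → S} {π : Measure S} {K : ℕ}
    {f : EuclideanSpace ℝ (Fin K) → S → ℝ} {θ₀ : EuclideanSpace ℝ (Fin K)}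
    {θ : ℝ → ℝ → Ω → EuclideanSpace ℝ (Fin K)} {ζ : ℝ → EuclideanSpace ℝ (Fin K)}

/-- Extends a path to negative times by its value at `0`, as the comparison estimate takes paths
continuous on all of `ℝ`. -/
lemma continuous_comp_max {E : Type*} [TopologicalSpace E] {x : ℝ → E}
    (hx : ContinuousOn x (Set.Ici 0)) : Continuous fun t => x (max t 0) :=
  hx.comp_continuous (continuous_id.max continuous_const) fun _ => Set.mem_Ici.2 (le_max_right _ _)

lemma TargetAssumption.continuous_integral_gradient [IsProbabilityMeasure π]
    (hf : TargetAssumption f π) :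
    Continuous fun θ => ∫ v, gradient (fun x => f x v) θ ∂π := by
  obtain ⟨L, hL⟩ := hf.lipschitz
  refine (LipschitzWith.of_dist_le_mul (K := L) fun x x' => ?_).continuous
  rw [dist_eq_norm, ← integral_sub (hf.integrable_gradient x) (hf.integrable_gradient x')]
  have := norm_integral_le_of_norm_le_const (μ := π) (C := L * dist x x')
    (f := fun v => gradient (fun x => f x v) x - gradient (fun x => f x v) x')
    (ae_of_all _ fun v => by rw [← dist_eq_norm]; exact (hL v).dist_le_mul x x')
  simpa using this

lemma IsFullGradientFlow.eq_sub_integral [IsProbabilityMeasure π] (hf : TargetAssumption f π)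
    (hζ : IsFullGradientFlow π f θ₀ ζ) {t : ℝ} (ht : 0 ≤ t) :
    ζ t = θ₀ - ∫ s in (0 : ℝ)..t, ∫ v, gradient (fun x => f x v) (ζ s) ∂π := by
  have hc : ContinuousOn ζ (Set.Ici 0) := fun s hs => (hζ.equation s hs).continuousWithinAt
  have hc' : ContinuousOn (fun s => -∫ v, gradient (fun x => f x v) (ζ s) ∂π) (Set.Icc 0 t) :=
    (hf.continuous_integral_gradient.comp_continuousOn (hc.mono Set.Icc_subset_Ici_self)).neg
  have := intervalIntegral.integral_eq_sub_of_hasDeriv_right_of_le ht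
    (hc.mono Set.Icc_subset_Ici_self) (fun s hs => (hζ.equation s hs.1.le).mono
      fun r hr => (hs.1.trans hr).le) (hc'.intervalIntegrable_of_Icc ht)
  rw [intervalIntegral.integral_neg, hζ.initial] at this
  rw [sub_eq_add_neg, this]
  abel

/-- The mean truncated distance between the stochastic gradient process and the full gradient
flow. -/
noncomputable def meanDist (Q : Measure Ω) (x : Ω → EuclideanSpace ℝ (Fin K))
    (z : EuclideanSpace ℝ (Fin K)) : ℝ :=
  ∫ ω, min 1 ‖x ω - z‖ ∂Q

lemma meanDist_nonneg (Q : Measure Ω) (x : Ω → EuclideanSpace ℝ (Fin K))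
    (z : EuclideanSpace ℝ (Fin K)) : 0 ≤ meanDist Q x z :=
  integral_nonneg fun ω => by positivity

lemma meanDist_le_one (Q : Measure Ω) [IsProbabilityMeasure Q]
    (x : Ω → EuclideanSpace ℝ (Fin K)) (z : EuclideanSpace ℝ (Fin K)) : meanDist Q x z ≤ 1 := by
  have := norm_integral_le_of_norm_le_const (μ := Q) (C := 1) (f := fun ω => min 1 ‖x ω - z‖)
    (ae_of_all _ fun ω => by
      rw [Real.norm_of_nonneg (by positivity)]; exact min_le_left _ _)
  simpa [meanDist] using (le_abs_self _).trans this

/-- The averaging principle, uniformly on compact time intervals. -/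
theorem eventually_meanDist_le [IsMarkovKernel P] [IsProbabilityMeasure π]
    (hV : IsFellerProcess ℱ P V) (hπ : IsInvariant P V π)
    (huniq : ∀ μ : Measure S, IsProbabilityMeasure μ → IsInvariant P V μ → μ = π)
    (hf : TargetAssumption f π)
    (hθ : ∀ ε ∈ Set.Ioo (0 : ℝ) 1, IsSGPC (startLaw P π) f V ε θ₀ (θ ε))
    (hζ : IsFullGradientFlow π f θ₀ ζ) {T e : ℝ} (hT : 0 < T) (he : 0 < e) :
    ∀ᶠ ε in 𝓝[>] (0 : ℝ), ∀ t ∈ Set.Icc 0 T, meanDist (startLaw P π) (θ ε t) (ζ t) ≤ e := by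
  obtain ⟨L', hL'⟩ := hf.lipschitz
  -- The `+ 1` provides the strictly positive constant that the Grönwall step divides by.
  set L : ℝ := L' + 1 with hL
  have hL0 : 0 < L := by positivity
  let g : EuclideanSpace ℝ (Fin K) → S → EuclideanSpace ℝ (Fin K) :=
    fun x v => gradient (fun x => f x v) x
  let G : EuclideanSpace ℝ (Fin K) → EuclideanSpace ℝ (Fin K) := fun x => ∫ v, g x v ∂π
  have hg : Continuous (Function.uncurry g) := hf.continuous_gradient
  have hG : Continuous G := hf.continuous_integral_gradient
  have hgL : ∀ x x' v, ‖g x v - g x' v‖ ≤ L * ‖x - x'‖ := fun x x' v => by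
    have := (hL' v).dist_le_mul x x'
    rw [dist_eq_norm, dist_eq_norm] at this
    exact this.trans (by gcongr; rw [hL]; linarith)
  have hζc := continuous_comp_max (x := ζ) fun s hs => (hζ.equation s hs).continuousWithinAt
  have hH : Continuous (Function.uncurry fun t v => g (ζ (max t 0)) v - G (ζ (max t 0))) :=
    (hg.comp ((hζc.comp continuous_fst).prodMk continuous_snd)).sub
      (hG.comp (hζc.comp continuous_fst))
  have hH0 : ∀ t, ∫ v, (g (ζ (max t 0)) v - G (ζ (max t 0))) ∂π = 0 := fun t => by
    rw [integral_sub (hf.integrable_gradient _) (integrable_const _)]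
    rw [integral_const, probReal_univ, one_smul]
    exact sub_self _
  set c := Real.exp (L * T) with hc
  have hc0 : 0 < c := Real.exp_pos _
  -- Grönwall multiplies errors by at most `c`, so the grid error and the mean of `B` are each
  -- allowed `e / (2 * c)`.
  obtain ⟨B, hBint, hB, hBlim⟩ := hV.exists_averaging_bound hπ huniq hH hH0 hT
    (show 0 < e / (2 * c) by positivity)
  filter_upwards [hBlim.eventually (gt_mem_nhds (show 0 < e / (2 * c) by positivity)),
    Ioo_mem_nhdsGT (zero_lt_one (α := ℝ))] with ε hε hε01 t ht
  have hmax : ∀ t ∈ Set.Icc 0 T, max t 0 = t := fun t ht => max_eq_left ht.1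
  have hpath : ∀ᵐ ω ∂(startLaw P π),
      min 1 ‖θ ε t ω - ζ t‖ ≤ (B ε ω + e / (2 * c)) * c := by
    filter_upwards [(hθ ε hε01).continuous, (hθ ε hε01).equation] with ω h1 h2
    have key := norm_sub_le_mul_exp (hV.measurable_path ε ω) hg hL0 hgL hG
      (continuous_comp_max h1) hζc (θ₀ := θ₀) (T := T) (B := B ε ω + e / (2 * c)) ?_ ?_
      (fun s hs => hB ε ω s hs) t ht
    · simp only [hmax t ht] at key
      have hBn : 0 ≤ B ε ω + e / (2 * c) := (norm_nonneg _).trans (hB ε ω t ht)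
      refine (min_le_right _ _).trans (key.trans (mul_le_mul_of_nonneg_left ?_ hBn))
      exact Real.exp_le_exp.2 (mul_le_mul_of_nonneg_left ht.2 hL0.le)
    · intro s hs
      rw [hmax s hs, h2 s hs.1]
      refine congrArg (θ₀ - ·) (intervalIntegral.integral_congr fun r hr => ?_)
      rw [Set.uIcc_of_le hs.1] at hr
      simp only [max_eq_left hr.1, g]
    · intro s hs
      rw [hmax s hs, hζ.eq_sub_integral hf hs.1]
      refine congrArg (θ₀ - ·) (intervalIntegral.integral_congr fun r hr => ?_)
      rw [Set.uIcc_of_le hs.1] at hr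
      simp only [max_eq_left hr.1, g, G]
  have hint : Integrable (fun ω => (B ε ω + e / (2 * c)) * c) (startLaw P π) :=
    ((hBint ε).add (integrable_const _)).mul_const _
  calc meanDist (startLaw P π) (θ ε t) (ζ t)
      ≤ ∫ ω, (B ε ω + e / (2 * c)) * c ∂(startLaw P π) :=
        integral_mono_of_nonneg (ae_of_all _ fun ω => by positivity) hint hpath
    _ = ((∫ ω, B ε ω ∂(startLaw P π)) + e / (2 * c)) * c := by
        rw [integral_mul_const, integral_add (hBint ε) (integrable_const _)]
        simp
    _ ≤ (e / (2 * c) + e / (2 * c)) * c := by gcongr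
    _ = e := by field_simp; ring

end Main

end SGP

theorem mainTheorem7
    {S : Type u} [TopologicalSpace S] [PolishSpace S] [CompactSpace S]
    [MeasurableSpace S] [BorelSpace S]
    {Ω : Type v} [mΩ : MeasurableSpace Ω] (ℱ : Filtration ℝ≥0 mΩ)
    (P : Kernel S Ω) [IsMarkovKernel P] (V : ℝ≥0 → Ω → S)
    (hV : SGP.IsFellerProcess ℱ P V)
    (π : Measure S) (hπ : SGP.IndexAssumption.{u, v, w} P V π)
    {K : ℕ} (f : EuclideanSpace ℝ (Fin K) → S → ℝ) (hf : SGP.TargetAssumption f π)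
    (θ₀ : EuclideanSpace ℝ (Fin K))
    (θ : ℝ → ℝ → Ω → EuclideanSpace ℝ (Fin K))
    (hθ : ∀ ε ∈ Set.Ioo (0 : ℝ) 1, SGP.IsSGPC (SGP.startLaw P π) f V ε θ₀ (θ ε))
    (ζ : ℝ → EuclideanSpace ℝ (Fin K)) (hζ : SGP.IsFullGradientFlow π f θ₀ ζ) :
    ∃ α : ℝ → ℝ,
      (∀ ε ∈ Set.Ioo (0 : ℝ) 1, α ε ∈ Set.Icc (0 : ℝ) 1) ∧
      Tendsto α (𝓝[>] 0) (𝓝 0) ∧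
      ∀ ε ∈ Set.Ioo (0 : ℝ) 1, ∀ t : ℝ, 0 ≤ t →
        SGP.wassersteinTrunc ((SGP.startLaw P π).map (θ ε t)) (Measure.dirac (ζ t)) ≤
          ENNReal.ofReal (min (Real.exp t * α ε) 1) := by

  have := hπ.prob
  -- The weight `e^{-t}` is exactly offset by the factor `e^t` in the conclusion.
  let D : ℝ → ℝ≥0 → ℝ := fun ε t => Real.exp (-t) * SGP.meanDist (SGP.startLaw P π) (θ ε t) (ζ t)
  have hD0 : ∀ ε t, 0 ≤ D ε t := fun ε t =>
    mul_nonneg (Real.exp_pos _).le (SGP.meanDist_nonneg _ _ _)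
  have hD_exp : ∀ ε t, D ε t ≤ Real.exp (-t) := fun ε t =>
    mul_le_of_le_one_right (Real.exp_pos _).le (SGP.meanDist_le_one _ _ _)
  have hD1 : ∀ ε t, D ε t ≤ 1 := fun ε t =>
    (hD_exp ε t).trans (Real.exp_le_one_iff.2 (neg_nonpos.2 t.coe_nonneg))
  have hbdd : ∀ ε, BddAbove (Set.range (D ε)) := fun ε => ⟨1, by rintro _ ⟨t, rfl⟩; exact hD1 ε t⟩
  have hα0 : ∀ ε, 0 ≤ ⨆ t, D ε t := fun ε => Real.iSup_nonneg (hD0 ε)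
  refine ⟨fun ε => ⨆ t, D ε t, fun ε _ => ⟨hα0 ε, ciSup_le (hD1 ε)⟩, ?_, ?_⟩
  · refine Metric.tendsto_nhds.2 fun e he => ?_
    obtain ⟨T, hT, hTe⟩ : ∃ T : ℝ, 0 < T ∧ Real.exp (-T) < e :=
      ((eventually_gt_atTop 0).and
        (Real.tendsto_exp_neg_atTop_nhds_zero.eventually (gt_mem_nhds he))).exists
    filter_upwards [SGP.eventually_meanDist_le hV hπ.invariant hπ.unique hf hθ hζ hT (half_pos he)]
      with ε hε
    rw [Real.dist_eq, sub_zero, abs_of_nonneg (hα0 ε)]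
    -- Up to `T` the averaging principle gives `e / 2`; beyond `T` the weight alone is at most `exp
    -- (-T)`. Both bounds are uniform in `t` and strictly below `e`, so the supremum is too.
    refine (ciSup_le fun t => ?_).trans_lt (max_lt (half_lt_self he) hTe)
    rcases le_total (t : ℝ) T with h | h
    · refine le_max_of_le_left (le_trans ?_ (hε t ⟨t.coe_nonneg, h⟩))
      exact mul_le_of_le_one_left (SGP.meanDist_nonneg _ _ _)
        (Real.exp_le_one_iff.2 (neg_nonpos.2 t.coe_nonneg))
    · exact le_max_of_le_right ((hD_exp ε t).trans (Real.exp_le_exp.2 (neg_le_neg h)))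
  · intro ε hε t ht
    have hm := (hθ ε hε).measurable t ht
    have := Measure.isProbabilityMeasure_map (μ := SGP.startLaw P π) hm.aemeasurable
    refine (SGP.wassersteinTrunc_dirac_le _ _).trans (ENNReal.ofReal_le_ofReal ?_)
    rw [integral_map hm.aemeasurable (by fun_prop)]
    refine le_min ?_ (SGP.meanDist_le_one _ _ _)
    have h : D ε ⟨t, ht⟩ ≤ ⨆ t, D ε t := le_ciSup (hbdd ε) _
    calc SGP.meanDist (SGP.startLaw P π) (θ ε t) (ζ t)
        = Real.exp t * D ε ⟨t, ht⟩ := by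
          change _ = Real.exp t * (Real.exp (-t) * _)
          rw [← mul_assoc, ← Real.exp_add, add_neg_cancel, Real.exp_zero, one_mul]
          rfl
      _ ≤ _ := by gcongr
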